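/- Conventions. All spaces are based; $*$ denotes a basepoint and $I=[0,1]$. A based space is well-pointed if the inclusion of its basepoint has the homotopy extension property. $[U,Z]$ is the set of based homotopy classes of based maps; $A\wedge X=(A\times X)/(A\times\{*\}\cup\{*\}\times X)$ is the smash product and $\Sigma A=(A\times I)/(A\times\{0,1\}\cup\{*\}\times I)$ the reduced suspension, so that $[\Sigma A,Z]$ is a group under concatenation in the suspension coordinate. For a continuous map $f\colon X\to Y$, $\mathrm{map}(X,Y;f)$ is the space of all unbased continuous maps $X\to Y$ that are freely homotopic to $f$, with the (subspace of the) compact-open topology, based at $f$. Write $\mathrm{map}(X,Y;0)$ for the case where $f$ is the constant map at the basepoint of $Y$, and $\mathrm{aut}_1 Z=\mathrm{map}(Z,Z;\mathrm{id}_Z)$. Let $\omega\colon \mathrm{aut}_1 Z\to Z$, $\omega(g)=g(*)$. The generalized Gottlieb group of $Z$ is the subgroup $$\mathcal G(\Sigma A,Z)=\mathrm{im}\big(\omega_*\colon[\Sigma A,\mathrm{aut}_1 Z]\to[\Sigma A,Z]\big)\subseteq[\Sigma A,Z].$$ Theorem. Let $X$, $Y$, $A$ be locally compact Hausdorff, well-pointed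 based spaces, with $X$ connected and $Y$ path-connected ($A$ may be disconnected). Let $\mathrm{ev}_Y\colon\mathrm{map}(X,Y;0)\to Y$, $g\mapsto g(*)$, be the evaluation map, let $\sigma_Y\colon Y\to\mathrm{map}(X,Y;0)$ be the null section sending $y$ to the constant map at $y$, and let $j\colon[\Sigma(A\wedge X),Y]\to[\Sigma A,\mathrm{map}(X,Y;0)]$ be the homomorphism given by the exponential law, $j[F]=\big[\,[a,t]\mapsto(x\mapsto F([a\wedge x,t]))\,\big]$. Then $\mathcal G(\Sigma(A\wedge X),Y)$, $\mathcal G(\Sigma A,\mathrm{map}(X,Y;0))$ and $\mathcal G(\Sigma A,Y)$ are abelian groups, the homomorphisms $j$, $(\mathrm{ev}_Y)_*$ and $(\sigma_Y)_*$ restrict to homomorphisms between them, and $$0\to\mathcal G(\Sigma(A\wedge X),Y)\xrightarrow{\ j\ }\mathcal G\big(\Sigma A,\mathrm{map}(X,Y;0)\big)\xrightarrow{(\mathrm{ev}_Y)_*}\mathcal G(\Sigma A,Y)\to0$$ is a short exact sequence split by $(\sigma_Y)_*$, that is, $(\mathrm{ev}_Y)_*\circ(\sigma_Y)_*=\mathrm{id}$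 on $\mathcal G(\Sigma A,Y)$. -/

import Mathlib

open Topology
open scoped unitInterval

universe u v w

noncomputable section

/-! ### Based spaces, based maps and based homotopy classes -/

/-- A choice of basepoint on a type. -/
class Based (X : Type u) where
  /-- The basepoint. -/
  pt : X

/-- A based space is well-pointed if the inclusion of the basepoint has the homotopy extension
property. (Test spaces in the universe of `X` suffice, because the subspace
`{0} × X ∪ I × {pt}` of `I × X` is a universal test space when the basepoint is closed.) -/
def WellPointed (X : Type u) [TopologicalSpace X] [Based X] : Prop :=
  ∀ (Z : Type u) [TopologicalSpace Z] (f : C(X, Z)) (γ : C(I, Z)), γ 0 = f Based.pt →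
    ∃ H : C(I × X, Z), (∀ x, H (0, x) = f x) ∧ ∀ t, H (t, Based.pt) = γ t

/-- Based (continuous, basepoint preserving) maps. -/
def BasedMap (X : Type u) (Y : Type v) [TopologicalSpace X] [TopologicalSpace Y]
    [Based X] [Based Y] : Type (max u v) :=
  {f : C(X, Y) // f Based.pt = Based.pt}

/-- Based homotopy of based maps. -/
instance BasedMap.setoid (X : Type u) (Y : Type v) [TopologicalSpace X] [TopologicalSpace Y]
    [Based X] [Based Y] : Setoid (BasedMap X Y) where
  r f g := ContinuousMap.HomotopicRel f.1 g.1 {Based.pt}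
  iseqv := ⟨fun f => .refl f.1, fun h => h.symm, fun h k => h.trans k⟩

/-- The set `[X, Y]` of based homotopy classes of based maps. -/
def BasedClasses (X : Type u) (Y : Type v) [TopologicalSpace X] [TopologicalSpace Y]
    [Based X] [Based Y] : Type (max u v) :=
  Quotient (BasedMap.setoid X Y)

/-- Composition of based maps. -/
def BasedMap.comp {X : Type u} {Y : Type v} {Z : Type w} [TopologicalSpace X]
    [TopologicalSpace Y] [TopologicalSpace Z] [Based X] [Based Y] [Based Z]
    (g : BasedMap Y Z) (f : BasedMap X Y) : BasedMap X Z :=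
  ⟨g.1.comp f.1, by rw [ContinuousMap.comp_apply, f.2, g.2]⟩

/-! ### Smash product and reduced suspension -/

/-- The equivalence relation on `X` that collapses the subset `S` to a point. -/
def collapseSetoid {X : Type u} (S : Set X) : Setoid X where
  r x y := x = y ∨ (x ∈ S ∧ y ∈ S)
  iseqv := by
    refine ⟨fun x => Or.inl rfl, ?_, ?_⟩
    · rintro x y (rfl | ⟨h, k⟩)
      · exact Or.inl rfl
      · exact Or.inr ⟨k, h⟩
    · rintro x y z (rfl | ⟨h, k⟩) (rfl | ⟨h', k'⟩)
      · exact Or.inl rfl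
      · exact Or.inr ⟨h', k'⟩
      · exact Or.inr ⟨h, k⟩
      · exact Or.inr ⟨h, k'⟩

/-- The smash product `A ∧ X = (A × X) / (A × {pt} ∪ {pt} × X)`. -/
def Smash (A : Type u) (X : Type v) [Based A] [Based X] : Type (max u v) :=
  Quotient (collapseSetoid {p : A × X | p.1 = Based.pt ∨ p.2 = Based.pt})

/-- The quotient topology. -/
instance (A : Type u) (X : Type v) [TopologicalSpace A] [TopologicalSpace X] [Based A] [Based X] :
    TopologicalSpace (Smash A X) :=
  inferInstanceAs (TopologicalSpace (Quotient (collapseSetoid _)))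

/-- The class of a pair in the smash product. -/
def Smash.mk {A : Type u} {X : Type v} [Based A] [Based X] (a : A) (x : X) : Smash A X :=
  Quotient.mk _ (a, x)

instance (A : Type u) (X : Type v) [Based A] [Based X] : Based (Smash A X) where
  pt := Smash.mk Based.pt Based.pt

/-- The reduced suspension `Σ A = (A × I) / (A × {0, 1} ∪ {pt} × I)`. -/
def Susp (A : Type u) [Based A] : Type u :=
  Quotient (collapseSetoid {p : A × I | p.1 = Based.pt ∨ p.2 = 0 ∨ p.2 = 1})

/-- The quotient topology. -/
instance (A : Type u) [TopologicalSpace A] [Based A] : TopologicalSpace (Susp A) :=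
  inferInstanceAs (TopologicalSpace (Quotient (collapseSetoid _)))

/-- The class `[a, t]` in the reduced suspension. -/
def Susp.mk {A : Type u} [Based A] (a : A) (t : I) : Susp A :=
  Quotient.mk _ (a, t)

instance (A : Type u) [Based A] : Based (Susp A) where
  pt := Susp.mk Based.pt 0

section basic

set_option linter.unusedSectionVars false

variable {A : Type u} {X : Type v} {Z : Type w} [TopologicalSpace A] [TopologicalSpace X]
  [TopologicalSpace Z] [Based A] [Based X] [Based Z]

theorem Smash.continuous_mk : Continuous fun p : A × X => Smash.mk p.1 p.2 :=
  continuous_quotient_mk'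

theorem Smash.mk_pt_left (x : X) : Smash.mk (Based.pt : A) x = Based.pt :=
  Quotient.sound (Or.inr ⟨Or.inl rfl, Or.inl rfl⟩)

theorem Smash.mk_pt_right (a : A) : Smash.mk a (Based.pt : X) = Based.pt :=
  Quotient.sound (Or.inr ⟨Or.inr rfl, Or.inl rfl⟩)

theorem Susp.isQuotientMap_mk : IsQuotientMap fun p : A × I => Susp.mk p.1 p.2 :=
  isQuotientMap_quotient_mk'

theorem Susp.continuous_mk : Continuous fun p : A × I => Susp.mk p.1 p.2 :=
  Susp.isQuotientMap_mk.continuous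

theorem Susp.mk_pt (t : I) : Susp.mk (Based.pt : A) t = Based.pt :=
  Quotient.sound (Or.inr ⟨Or.inl rfl, Or.inl rfl⟩)

theorem Susp.mk_zero (a : A) : Susp.mk a 0 = Based.pt :=
  Quotient.sound (Or.inr ⟨Or.inr (Or.inl rfl), Or.inl rfl⟩)

theorem Susp.mk_one (a : A) : Susp.mk a 1 = Based.pt :=
  Quotient.sound (Or.inr ⟨Or.inr (Or.inr rfl), Or.inl rfl⟩)

theorem Susp.ind {p : Susp A → Prop} (h : ∀ a t, p (Susp.mk a t)) (s : Susp A) : p s := by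
  induction s using Quotient.inductionOn with
  | h q => exact h q.1 q.2

/-! ### The group `[Σ A, Z]` -/

/-- The loop `t ↦ f [a, t]`. -/
def BasedMap.loop (f : BasedMap (Susp A) Z) (a : A) : Path (Based.pt : Z) Based.pt where
  toFun t := f.1 (Susp.mk a t)
  continuous_toFun := f.1.continuous.comp
    (Susp.continuous_mk.comp (by fun_prop : Continuous fun t : I => (a, t)))
  source' := by rw [Susp.mk_zero, f.2]
  target' := by rw [Susp.mk_one, f.2]

theorem BasedMap.continuous_loop (f : BasedMap (Susp A) Z) : Continuous ↿f.loop :=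
  f.1.continuous.comp Susp.continuous_mk

theorem BasedMap.loop_pt (f : BasedMap (Susp A) Z) : f.loop Based.pt = Path.refl _ := by
  ext t
  change f.1 (Susp.mk _ t) = _
  rw [Susp.mk_pt, f.2]; rfl

/-- The based map `Σ A → Z`, `[a, t] ↦ γ a t`, given by a continuous family of loops. -/
def BasedMap.ofLoops (γ : A → Path (Based.pt : Z) Based.pt) (hγ : Continuous ↿γ)
    (h : γ Based.pt = Path.refl _) : BasedMap (Susp A) Z where
  val :=
    { toFun := Quotient.lift (fun p : A × I => γ p.1 p.2) (by
        have key : ∀ p : A × I, (p.1 = Based.pt ∨ p.2 = 0 ∨ p.2 = 1) →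
            γ p.1 p.2 = Based.pt := by
          rintro ⟨a, t⟩ (h1 | h1 | h1)
          · simp only at h1; subst h1; rw [h]; rfl
          · simp only at h1; subst h1; simp
          · simp only at h1; subst h1; simp
        rintro p q (rfl | ⟨hp, hq⟩)
        · rfl
        · rw [key p hp, key q hq])
      continuous_toFun := Continuous.quotient_lift hγ _ }
  property := by
    change γ Based.pt 0 = _
    simp

theorem BasedMap.ext_loop {f g : BasedMap (Susp A) Z} (h : ∀ a, f.loop a = g.loop a) : f = g := by
  apply Subtype.ext
  ext s
  induction s using Susp.ind with
  | h a t => exact congrArg (fun p : Path (Based.pt : Z) Based.pt => p t) (h a)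

theorem BasedMap.loop_ofLoops (γ : A → Path (Based.pt : Z) Based.pt) (hγ : Continuous ↿γ)
    (h : γ Based.pt = Path.refl _) (a : A) : (BasedMap.ofLoops γ hγ h).loop a = γ a := rfl

/-- A continuous family of families of loops gives a based homotopy. -/
theorem BasedMap.equiv_of_family {f g : BasedMap (Susp A) Z}
    (Γ : I × A → Path (Based.pt : Z) Based.pt) (hΓ : Continuous ↿Γ)
    (hpt : ∀ s, Γ (s, Based.pt) = Path.refl _)
    (h0 : ∀ a, Γ (0, a) = f.loop a) (h1 : ∀ a, Γ (1, a) = g.loop a) : f ≈ g := by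
  let K : I → BasedMap (Susp A) Z := fun s =>
    BasedMap.ofLoops (fun a => Γ (s, a))
      (hΓ.comp (show Continuous fun p : A × I => ((s, p.1), p.2) by fun_prop)) (hpt s)
  have e0 : K 0 = f := BasedMap.ext_loop h0
  have e1 : K 1 = g := BasedMap.ext_loop h1
  refine ⟨{ toFun := fun p => (K p.1).1 p.2, continuous_toFun := ?_, map_zero_left := ?_,
            map_one_left := ?_, prop' := ?_ }⟩
  · refine Susp.isQuotientMap_mk.continuous_lift_prod_right ?_
    exact hΓ.comp (show Continuous fun p : I × A × I => ((p.1, p.2.1), p.2.2) by fun_prop)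
  · intro x; simp only [e0]
  · intro x; simp only [e1]
  · rintro s x rfl
    exact (K s).2.trans f.2.symm

/-- A based homotopy gives a continuous family of families of loops. -/
theorem BasedMap.exists_family {f g : BasedMap (Susp A) Z} (h : f ≈ g) :
    ∃ K : I → BasedMap (Susp A) Z, Continuous (fun p : I × Susp A => (K p.1).1 p.2) ∧
      K 0 = f ∧ K 1 = g := by
  obtain ⟨H⟩ := h
  refine ⟨fun s => ⟨⟨fun x => H (s, x), by fun_prop⟩, ?_⟩, ?_, ?_, ?_⟩
  · exact (H.eq_fst s rfl).trans f.2
  · exact H.continuous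
  · exact Subtype.ext (ContinuousMap.ext fun x => H.apply_zero x)
  · exact Subtype.ext (ContinuousMap.ext fun x => H.apply_one x)

theorem BasedMap.continuous_family {K : I → BasedMap (Susp A) Z}
    (hK : Continuous (fun p : I × Susp A => (K p.1).1 p.2)) :
    Continuous ↿(fun q : I × A => (K q.1).loop q.2) :=
  hK.comp (show Continuous fun p : (I × A) × I => (p.1.1, Susp.mk p.1.2 p.2) from
    (by fun_prop : Continuous fun p : (I × A) × I => p.1.1).prodMk
      (Susp.continuous_mk.comp (by fun_prop : Continuous fun p : (I × A) × I => (p.1.2, p.2))))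

/-- The constant based map. -/
def BasedMap.one : BasedMap (Susp A) Z := ⟨ContinuousMap.const _ Based.pt, rfl⟩

/-- The product `f * g : Σ A → Z`: on each line `{a} × I` it is `f` followed by `g`. -/
def BasedMap.mul (f g : BasedMap (Susp A) Z) : BasedMap (Susp A) Z :=
  BasedMap.ofLoops (fun a => (f.loop a).trans (g.loop a))
    (Path.trans_continuous_family _ f.continuous_loop _ g.continuous_loop)
    (by rw [f.loop_pt, g.loop_pt, Path.refl_trans_refl])

/-- The inverse of `f : Σ A → Z`: on each line `{a} × I` it is `f` run backwards. -/
def BasedMap.inv (f : BasedMap (Susp A) Z) : BasedMap (Susp A) Z :=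
  BasedMap.ofLoops (fun a => (f.loop a).symm)
    (Path.symm_continuous_family _ f.continuous_loop) (by rw [f.loop_pt, Path.refl_symm])

theorem BasedMap.mul_apply (f g : BasedMap (Susp A) Z) (a : A) (t : I) :
    (f.mul g).1 (Susp.mk a t) = (f.loop a).trans (g.loop a) t := rfl

theorem BasedMap.mul_equiv {f f' g g' : BasedMap (Susp A) Z} (hf : f ≈ f') (hg : g ≈ g') :
    f.mul g ≈ f'.mul g' := by
  obtain ⟨K, hK, rfl, rfl⟩ := BasedMap.exists_family hf
  obtain ⟨L, hL, rfl, rfl⟩ := BasedMap.exists_family hg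
  exact BasedMap.equiv_of_family (fun q => ((K q.1).mul (L q.1)).loop q.2)
    (Path.trans_continuous_family _ (BasedMap.continuous_family hK) _
      (BasedMap.continuous_family hL))
    (fun s => BasedMap.loop_pt _) (fun _ => rfl) (fun _ => rfl)

theorem BasedMap.inv_equiv {f f' : BasedMap (Susp A) Z} (hf : f ≈ f') : f.inv ≈ f'.inv := by
  obtain ⟨K, hK, rfl, rfl⟩ := BasedMap.exists_family hf
  exact BasedMap.equiv_of_family (fun q => ((K q.1).inv).loop q.2)
    (Path.symm_continuous_family _ (BasedMap.continuous_family hK))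
    (fun s => BasedMap.loop_pt _) (fun _ => rfl) (fun _ => rfl)

/-- Reparametrizing the suspension coordinate does not change the based homotopy class. -/
theorem BasedMap.reparam_equiv {f g : BasedMap (Susp A) Z} (ρ : I → I) (hρ : Continuous ρ)
    (h0 : ρ 0 = 0) (h1 : ρ 1 = 1) (h : ∀ a, g.loop a = (f.loop a).reparam ρ hρ h0 h1) :
    f ≈ g := by
  refine BasedMap.equiv_of_family
    (fun q => (Path.Homotopy.reparam (f.loop q.2) ρ hρ h0 h1).eval q.1) ?_ ?_ ?_ ?_
  · refine f.continuous_loop.comp (show Continuous fun p : (I × A) × I => (p.1.2,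
      (⟨unitInterval.symm p.1.1 * p.2 + p.1.1 * ρ p.2, _⟩ : I)) from ?_)
    fun_prop
  · intro s
    ext t
    change f.loop _ _ = _
    rw [f.loop_pt]; rfl
  · intro a
    exact Path.Homotopy.eval_zero _
  · intro a
    rw [Path.Homotopy.eval_one, h]

theorem BasedMap.mul_assoc_equiv (f g h : BasedMap (Susp A) Z) :
    (f.mul g).mul h ≈ f.mul (g.mul h) :=
  Setoid.symm <| BasedMap.reparam_equiv _ _ _ _ fun a =>
    Path.Homotopy.trans_assoc_reparam (f.loop a) (g.loop a) (h.loop a)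

theorem BasedMap.mul_one_equiv (f : BasedMap (Susp A) Z) : f.mul BasedMap.one ≈ f :=
  Setoid.symm <| BasedMap.reparam_equiv _ _ _ _ fun a =>
    Path.Homotopy.trans_refl_reparam (f.loop a)

theorem BasedMap.mul_inv_equiv (f : BasedMap (Susp A) Z) : f.mul f.inv ≈ BasedMap.one := by
  refine Setoid.symm <| BasedMap.equiv_of_family
    (fun q => (Path.Homotopy.reflTransSymm (f.loop q.2)).eval q.1) ?_ ?_ ?_ ?_
  · refine f.continuous_loop.comp (show Continuous fun p : (I × A) × I => (p.1.2,
      (⟨Path.Homotopy.reflTransSymmAux (p.1.1, p.2), _⟩ : I)) from ?_)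
    fun_prop
  · intro s
    ext t
    change f.loop _ _ = _
    rw [f.loop_pt]; rfl
  · intro a
    exact Path.Homotopy.eval_zero _
  · intro a
    exact Path.Homotopy.eval_one _

instance : Mul (BasedClasses (Susp A) Z) where
  mul := Quotient.map₂ BasedMap.mul fun _ _ h _ _ k => BasedMap.mul_equiv h k

instance : One (BasedClasses (Susp A) Z) where
  one := Quotient.mk _ BasedMap.one

instance : Inv (BasedClasses (Susp A) Z) where
  inv := Quotient.map BasedMap.inv fun _ _ h => BasedMap.inv_equiv h

/-- The group `[Σ A, Z]`. -/
instance : Group (BasedClasses (Susp A) Z) :=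
  Group.ofRightAxioms
    (by rintro ⟨f⟩ ⟨g⟩ ⟨h⟩; exact Quotient.sound (BasedMap.mul_assoc_equiv f g h))
    (by rintro ⟨f⟩; exact Quotient.sound (BasedMap.mul_one_equiv f))
    (by rintro ⟨f⟩; exact Quotient.sound (BasedMap.mul_inv_equiv f))

end basic

/-- The homomorphism `g_* : [Σ A, Y] → [Σ A, Z]` given by composition with a based map `g`. -/
def inducedHom (A : Type u) {Y : Type v} {Z : Type w} [TopologicalSpace A] [TopologicalSpace Y]
    [TopologicalSpace Z] [Based A] [Based Y] [Based Z] (g : BasedMap Y Z) :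
    BasedClasses (Susp A) Y →* BasedClasses (Susp A) Z :=
  MonoidHom.mk' (Quotient.map (fun f => g.comp f) fun _ _ h => h.comp_continuousMap g.1) (by
    rintro ⟨f⟩ ⟨f'⟩
    refine congrArg (Quotient.mk _) (BasedMap.ext_loop fun a => ?_)
    ext t
    change g.1 ((f.mul f').1 (Susp.mk a t)) = ((g.comp f).mul (g.comp f')).1 (Susp.mk a t)
    rw [BasedMap.mul_apply, BasedMap.mul_apply, Path.trans_apply, Path.trans_apply]
    split_ifs <;> rfl)

/-! ### Function spaces and generalized Gottlieb groups -/

/-- The component `map(X, Y; f)` of the function space of unbased maps `X → Y` (with the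
compact-open topology) that consists of the maps freely homotopic to `f`. -/
def MapComp {X : Type u} {Y : Type v} [TopologicalSpace X] [TopologicalSpace Y] (f : C(X, Y)) :
    Type (max u v) :=
  {g : C(X, Y) // ContinuousMap.Homotopic g f}

section components

variable {X : Type u} {Y : Type v} [TopologicalSpace X] [TopologicalSpace Y]

/-- The subspace topology of the compact-open topology. -/
instance (f : C(X, Y)) : TopologicalSpace (MapComp f) :=
  inferInstanceAs (TopologicalSpace {g : C(X, Y) // ContinuousMap.Homotopic g f})

instance (f : C(X, Y)) : Based (MapComp f) where
  pt := ⟨f, ContinuousMap.Homotopic.refl f⟩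

end components

/-- `aut₁ Z`: the self-maps of `Z` freely homotopic to the identity, based at the identity.
(Every such map is a homotopy equivalence.) -/
abbrev Aut₁ (Z : Type u) [TopologicalSpace Z] : Type u :=
  MapComp (ContinuousMap.id Z)

/-- The evaluation map `ω : aut₁ Z → Z` at the basepoint. -/
def evalAut (Z : Type u) [TopologicalSpace Z] [Based Z] : BasedMap (Aut₁ Z) Z where
  val := ⟨fun g => g.1 Based.pt,
    (continuous_eval_const _).comp continuous_subtype_val⟩
  property := rfl

/-- The generalized Gottlieb group `𝒢(Σ A, Z)`: the image of `ω_* : [Σ A, aut₁ Z] → [Σ A, Z]`. -/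
def gottlieb (A : Type u) (Z : Type v) [TopologicalSpace A] [TopologicalSpace Z] [Based A]
    [Based Z] : Subgroup (BasedClasses (Susp A) Z) :=
  (inducedHom A (evalAut Z)).range

/-- `map(X, Y; 0)`: the component of the constant map at the basepoint of `Y`. -/
abbrev NullMap (X : Type u) (Y : Type v) [TopologicalSpace X] [TopologicalSpace Y] [Based Y] :
    Type (max u v) :=
  MapComp (ContinuousMap.const X (Based.pt : Y))

section main

set_option linter.unusedSectionVars false

variable (A : Type w) (X : Type u) (Y : Type v) [TopologicalSpace A] [TopologicalSpace X]
  [TopologicalSpace Y] [Based A] [Based X] [Based Y]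

/-- Evaluation at the basepoint, `ev : map(X, Y; 0) → Y`. -/
def evNull : BasedMap (NullMap X Y) Y where
  val := ⟨fun g => g.1 Based.pt,
    (continuous_eval_const _).comp continuous_subtype_val⟩
  property := rfl

theorem const_homotopic_const [PathConnectedSpace Y] (y : Y) :
    ContinuousMap.Homotopic (ContinuousMap.const X y) (ContinuousMap.const X Based.pt) := by
  obtain ⟨p⟩ := PathConnectedSpace.joined y (Based.pt : Y)
  exact ⟨{ toFun := fun q => p q.1, map_zero_left := by simp, map_one_left := by simp }⟩

/-- The null section `σ : Y → map(X, Y; 0)`, sending `y` to the constant map at `y`. -/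
def nullSection [PathConnectedSpace Y] : BasedMap Y (NullMap X Y) where
  val := ⟨fun y => ⟨ContinuousMap.const X y, const_homotopic_const X Y y⟩,
    Continuous.subtype_mk ContinuousMap.continuous_const' _⟩
  property := rfl

variable {A X Y}

theorem continuous_smash_slice (F : BasedMap (Susp (Smash A X)) Y) :
    Continuous fun p : (A × I) × X => F.1 (Susp.mk (Smash.mk p.1.1 p.2) p.1.2) :=
  F.1.continuous.comp (Susp.continuous_mk.comp
    ((Smash.continuous_mk.comp
      (by fun_prop : Continuous fun p : (A × I) × X => (p.1.1, p.2))).prodMk (by fun_prop)))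

/-- For `F : Σ(A ∧ X) → Y`, the map `x ↦ F [a ∧ x, t]`, which is null-homotopic. -/
def smashSlice (F : BasedMap (Susp (Smash A X)) Y) (a : A) (t : I) : NullMap X Y where
  val := ⟨fun x => F.1 (Susp.mk (Smash.mk a x) t),
    (continuous_smash_slice F).comp (by fun_prop : Continuous fun x : X => ((a, t), x))⟩
  property := ⟨{
    toFun := fun q => F.1 (Susp.mk (Smash.mk a q.2) (unitInterval.symm q.1 * t))
    continuous_toFun := (continuous_smash_slice F).comp
      (by fun_prop : Continuous fun q : I × X => ((a, unitInterval.symm q.1 * t), q.2))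
    map_zero_left := by intro x; simp
    map_one_left := by intro x; simp [Susp.mk_zero, F.2] }⟩

theorem continuous_smashSlice (F : BasedMap (Susp (Smash A X)) Y) :
    Continuous fun p : A × I => smashSlice F p.1 p.2 :=
  Continuous.subtype_mk
    (ContinuousMap.continuous_of_continuous_uncurry _ (continuous_smash_slice F)) _

/-- The adjoint `Σ A → map(X, Y; 0)`, `[a, t] ↦ (x ↦ F [a ∧ x, t])`, of a based map
`F : Σ(A ∧ X) → Y`. -/
def BasedMap.adjoint (F : BasedMap (Susp (Smash A X)) Y) : BasedMap (Susp A) (NullMap X Y) :=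
  BasedMap.ofLoops
    (fun a =>
      { toFun := fun t => smashSlice F a t
        continuous_toFun := (continuous_smashSlice F).comp
          (by fun_prop : Continuous fun t : I => (a, t))
        source' := Subtype.ext (ContinuousMap.ext fun x =>
          show F.1 _ = Based.pt by rw [Susp.mk_zero, F.2])
        target' := Subtype.ext (ContinuousMap.ext fun x =>
          show F.1 _ = Based.pt by rw [Susp.mk_one, F.2]) })
    (continuous_smashSlice F)
    (by
      ext t
      refine Subtype.ext (ContinuousMap.ext fun x => ?_)
      change F.1 _ = Based.pt
      rw [Smash.mk_pt_left, Susp.mk_pt, F.2])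

theorem BasedMap.adjoint_equiv {F G : BasedMap (Susp (Smash A X)) Y} (h : F ≈ G) :
    F.adjoint ≈ G.adjoint := by
  obtain ⟨K, hK, rfl, rfl⟩ := BasedMap.exists_family h
  refine BasedMap.equiv_of_family (fun q => (K q.1).adjoint.loop q.2) ?_
    (fun s => BasedMap.loop_pt _) (fun _ => rfl) (fun _ => rfl)
  refine Continuous.subtype_mk (ContinuousMap.continuous_of_continuous_uncurry _ ?_) _
  exact hK.comp (show Continuous fun p : ((I × A) × I) × X =>
      (p.1.1.1, Susp.mk (Smash.mk p.1.1.2 p.2) p.1.2) from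
    (by fun_prop : Continuous fun p : ((I × A) × I) × X => p.1.1.1).prodMk
      (Susp.continuous_mk.comp ((Smash.continuous_mk.comp
        (by fun_prop : Continuous fun p : ((I × A) × I) × X => (p.1.1.2, p.2))).prodMk
          (by fun_prop))))

variable (A X Y)

/-- The homomorphism `[Σ(A ∧ X), Y] → [Σ A, map(X, Y; 0)]` induced by the exponential law. -/
def adjointHom : BasedClasses (Susp (Smash A X)) Y →* BasedClasses (Susp A) (NullMap X Y) :=
  MonoidHom.mk' (Quotient.map BasedMap.adjoint fun _ _ h => BasedMap.adjoint_equiv h) (by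
    rintro ⟨F⟩ ⟨G⟩
    refine congrArg (Quotient.mk _) (BasedMap.ext_loop fun a => ?_)
    ext t
    refine Subtype.ext (ContinuousMap.ext fun x => ?_)
    change (F.mul G).1 (Susp.mk (Smash.mk a x) t) =
      ((F.adjoint.mul G.adjoint).1 (Susp.mk a t)).1 x
    rw [BasedMap.mul_apply, BasedMap.mul_apply, Path.trans_apply, Path.trans_apply]
    split_ifs <;> rfl)

end main

end

/-! For any path-connected `W`, evaluation at the basepoint of `X` splits `[ΣA, map(X, W; 0)]`
through the null section. Its kernel is `[Σ(A ∧ X), W]`: if a family of maps `X → W` has a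
contractible trace at the basepoint, well-pointedness of `X` lets one deform the family until the
trace is constant (`exists_adjointHom_eq`, `adjointHom_injective`).

The Gottlieb version compares `W = Y` with `W = aut₁ Y`. Families in `aut₁ Y` act on `map(X, Y; 0)`
by postcomposition, pointwise in `x`, so `j` and `σ_*` preserve Gottlieb classes. Conversely,
restricting self-maps of `map(X, Y; 0)` to the constant maps lifts a Gottlieb class `β` to a class
`θ` in `[ΣA, map(X, aut₁ Y; 0)]` (`exists_aut_nullMap`). Dividing `θ` by its null-section part gives
a class coming from `[Σ(A ∧ X), aut₁ Y]`. If `ev_* β = 1`, the divisor dies under `ω`, so `β` is the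
adjoint of a Gottlieb class.

Commutativity holds because a family in `aut₁ Z` applied to a family in `Z`, with independent
suspension coordinates, fills a square whose edges are the two classes. -/

/-! ### Maps and homotopies out of `Σ(A ∧ X)` -/

section smashFamily

variable {A : Type w} {X : Type u} {W : Type v} [TopologicalSpace A] [TopologicalSpace X]
  [TopologicalSpace W] [Based A] [Based X] [Based W]

theorem Smash.isQuotientMap_mk :
    IsQuotientMap fun p : A × X => (Smash.mk p.1 p.2 : Smash A X) :=
  isQuotientMap_quotient_mk'

/-- A function on `(A × I) × X` that sends to the basepoint everything that is collapsed in
`Σ(A ∧ X)`. -/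
def VanishesOnCollapse (φ : (A × I) × X → W) : Prop :=
  ∀ a t x, (a = Based.pt ∨ t = 0 ∨ t = 1 ∨ x = Based.pt) → φ ((a, t), x) = Based.pt

/-- The function on `(A ∧ X) × I` induced by a function on `(A × I) × X`. -/
def smashLift (φ : (A × I) × X → W) (h : VanishesOnCollapse φ) (z : Smash A X) (t : I) : W :=
  Quotient.lift (fun p : A × X => φ ((p.1, t), p.2)) (by
    have key : ∀ p : A × X, (p.1 = Based.pt ∨ p.2 = Based.pt) →
        φ ((p.1, t), p.2) = Based.pt := fun p hp => h _ _ _ (by tauto)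
    rintro p q (rfl | ⟨hp, hq⟩)
    · rfl
    · exact (key p hp).trans (key q hq).symm) z

/-- Since `T × I` is locally compact, multiplying the quotient map `A × X → A ∧ X` by it gives a
quotient map again; no condition on `A` or `X` is needed. -/
theorem continuous_smashLift {T : Type*} [TopologicalSpace T] [LocallyCompactSpace T]
    (Φ : T → (A × I) × X → W) (hΦ : Continuous fun p : T × (A × I) × X => Φ p.1 p.2)
    (h : ∀ s, VanishesOnCollapse (Φ s)) :
    Continuous fun p : (T × Smash A X) × I => smashLift (Φ p.1.1) (h p.1.1) p.1.2 p.2 := by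
  have : Continuous fun p : (T × I) × Smash A X =>
      smashLift (Φ p.1.1) (h p.1.1) p.2 p.1.2 := by
    refine Smash.isQuotientMap_mk.continuous_lift_prod_right ?_
    exact hΦ.comp (show Continuous fun p : (T × I) × A × X =>
      (p.1.1, (p.2.1, p.1.2), p.2.2) by fun_prop)
  exact this.comp (show Continuous fun p : (T × Smash A X) × I =>
    ((p.1.1, p.2), p.1.2) by fun_prop)

/-- The loops in `W` parametrized by `A ∧ X`, given by a continuous map on `(A × I) × X`. -/
def smashLoop (φ : (A × I) × X → W) (hφ : Continuous φ) (h : VanishesOnCollapse φ)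
    (z : Smash A X) : Path (Based.pt : W) Based.pt where
  toFun t := smashLift φ h z t
  continuous_toFun :=
    (continuous_smashLift (fun _ : Unit => φ) (hφ.comp continuous_snd) (fun _ => h)).comp
      (show Continuous fun t : I => (((), z), t) by fun_prop)
  source' := by
    induction z using Quotient.inductionOn with
    | h p => exact h _ _ _ (by tauto)
  target' := by
    induction z using Quotient.inductionOn with
    | h p => exact h _ _ _ (by tauto)

theorem smashLoop_pt (φ : (A × I) × X → W) (hφ : Continuous φ) (h : VanishesOnCollapse φ) :
    smashLoop φ hφ h Based.pt = Path.refl _ := by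
  ext t
  exact h _ _ _ (Or.inl rfl)

/-- The based map `Σ(A ∧ X) → W`, `[a ∧ x, t] ↦ φ ((a, t), x)`. -/
def BasedMap.ofSmash (φ : (A × I) × X → W) (hφ : Continuous φ) (h : VanishesOnCollapse φ) :
    BasedMap (Susp (Smash A X)) W :=
  BasedMap.ofLoops (smashLoop φ hφ h)
    ((continuous_smashLift (fun _ : Unit => φ) (hφ.comp continuous_snd) (fun _ => h)).comp
      (show Continuous fun p : Smash A X × I => (((), p.1), p.2) by fun_prop))
    (smashLoop_pt φ hφ h)

theorem BasedMap.ofSmash_mk (φ : (A × I) × X → W) (hφ : Continuous φ)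
    (h : VanishesOnCollapse φ) (a : A) (x : X) (t : I) :
    (BasedMap.ofSmash φ hφ h).1 (Susp.mk (Smash.mk a x) t) = φ ((a, t), x) := rfl

theorem BasedMap.ext_smash {f g : BasedMap (Susp (Smash A X)) W}
    (h : ∀ a x t, f.1 (Susp.mk (Smash.mk a x) t) = g.1 (Susp.mk (Smash.mk a x) t)) : f = g := by
  refine BasedMap.ext_loop fun z => ?_
  induction z using Quotient.inductionOn with
  | h p => ext t; exact h p.1 p.2 t

/-- A homotopy on `(A × I) × X` that respects the collapsed part gives a based homotopy. -/
theorem BasedMap.equiv_of_smash_family {f g : BasedMap (Susp (Smash A X)) W}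
    (Φ : I → (A × I) × X → W) (hΦ : Continuous fun p : I × (A × I) × X => Φ p.1 p.2)
    (h : ∀ s, VanishesOnCollapse (Φ s))
    (h0 : ∀ a x t, Φ 0 ((a, t), x) = f.1 (Susp.mk (Smash.mk a x) t))
    (h1 : ∀ a x t, Φ 1 ((a, t), x) = g.1 (Susp.mk (Smash.mk a x) t)) : f ≈ g := by
  have hc : ∀ s, Continuous (Φ s) := fun s =>
    hΦ.comp (show Continuous fun q : (A × I) × X => (s, q) by fun_prop)
  have e0 : BasedMap.ofSmash (Φ 0) (hc 0) (h 0) = f := BasedMap.ext_smash h0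
  have e1 : BasedMap.ofSmash (Φ 1) (hc 1) (h 1) = g := BasedMap.ext_smash h1
  rw [← e0, ← e1]
  exact BasedMap.equiv_of_family (fun q => smashLoop (Φ q.1) (hc q.1) (h q.1) q.2)
    (continuous_smashLift Φ hΦ h) (fun s => smashLoop_pt _ _ _) (fun _ => rfl) (fun _ => rfl)

end smashFamily

/-! ### Maps from a suspension into a component of a function space -/

section compFamily

variable {B : Type w} {X : Type u} {Y : Type v} [TopologicalSpace B] [TopologicalSpace X]
  [TopologicalSpace Y] [Based B]

/-- A jointly continuous family of maps `X → Y` parametrized by `B × I` that is constantly `f`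
on the part collapsed in `Σ B` gives a based map `Σ B → map(X, Y; f)`. -/
def BasedMap.ofMaps {f : C(X, Y)} (φ : (B × I) × X → Y) (hφ : Continuous φ)
    (h : ∀ b t, (b = Based.pt ∨ t = 0 ∨ t = 1) → ∀ x, φ ((b, t), x) = f x) :
    BasedMap (Susp B) (MapComp f) :=
  let ψ : B × I → MapComp f := fun p =>
    ⟨⟨fun x => φ (p, x), by fun_prop⟩, ⟨{
      -- Shrinking the suspension coordinate to `0`, where the family is `f`, shows that each member
      -- lies in the component of `f`.
      toFun := fun q => φ ((p.1, unitInterval.symm q.1 * p.2), q.2)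
      continuous_toFun := by fun_prop
      map_zero_left := by simp
      map_one_left := fun x => h _ _ (by simp) x }⟩⟩
  have hψ : Continuous ψ := Continuous.subtype_mk
    (ContinuousMap.continuous_of_continuous_uncurry
      (fun p => (⟨fun x => φ (p, x), by fun_prop⟩ : C(X, Y))) hφ) _
  have hpt : ∀ b t, (b = Based.pt ∨ t = 0 ∨ t = 1) → ψ (b, t) = Based.pt := fun b t hb =>
    Subtype.ext (ContinuousMap.ext (h b t hb))
  BasedMap.ofLoops
    (fun b =>
      { toFun := fun t => ψ (b, t)
        continuous_toFun := hψ.comp (by fun_prop)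
        source' := hpt _ _ (by simp)
        target' := hpt _ _ (by simp) })
    hψ
    (by ext t; exact hpt _ _ (by simp))

theorem BasedMap.apply_collapsed {Z : Type*} [TopologicalSpace Z] [Based Z]
    (f : BasedMap (Susp B) Z) {b : B} {t : I} (h : b = Based.pt ∨ t = 0 ∨ t = 1) :
    f.1 (Susp.mk b t) = Based.pt := by
  rcases h with rfl | rfl | rfl
  · rw [Susp.mk_pt, f.2]
  · rw [Susp.mk_zero, f.2]
  · rw [Susp.mk_one, f.2]

theorem BasedMap.continuous_comp_mk {Z : Type*} [TopologicalSpace Z] [Based Z]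
    (f : BasedMap (Susp B) Z) : Continuous fun p : B × I => f.1 (Susp.mk p.1 p.2) :=
  f.1.continuous.comp Susp.continuous_mk

end compFamily

/-! ### Commutativity of generalized Gottlieb groups -/

section commute

variable {B : Type u} {Z : Type v} [TopologicalSpace B] [TopologicalSpace Z] [Based B] [Based Z]

/-- Two maps `Σ B → Z` commute up to homotopy if they are the edges of a family of squares. -/
theorem BasedMap.mul_comm_of_square {f g : BasedMap (Susp B) Z} (T : B → I × I → Z)
    (hT : Continuous fun p : B × I × I => T p.1 p.2)
    (hpt : ∀ q, T Based.pt q = Based.pt)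
    (hf0 : ∀ b t, T b (t, 0) = f.1 (Susp.mk b t)) (hf1 : ∀ b t, T b (t, 1) = f.1 (Susp.mk b t))
    (hg0 : ∀ b s, T b (0, s) = g.1 (Susp.mk b s)) (hg1 : ∀ b s, T b (1, s) = g.1 (Susp.mk b s)) :
    f.mul g ≈ g.mul f := by
  have : ContractibleSpace I :=
    (convex_Icc (0 : ℝ) 1).contractibleSpace ⟨0, unitInterval.zero_mem⟩
  let e : Path (0 : I) 1 := ⟨.id I, rfl, rfl⟩
  -- The two routes along the boundary of the square from `(0, 0)` to `(1, 1)` read off `f * g` and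
  -- `g * f` under `T`; they are homotopic because the square is simply connected.
  obtain ⟨H⟩ : Path.Homotopic ((e.prod (.refl 0)).trans ((Path.refl 1).prod e))
      (((Path.refl 0).prod e).trans (e.prod (.refl 1))) := SimplyConnectedSpace.paths_homotopic _ _
  refine BasedMap.equiv_of_family (fun q =>
    { toFun := fun t => T q.2 (H (q.1, t))
      continuous_toFun := hT.comp (show Continuous fun t : I => (q.2, H (q.1, t)) by fun_prop)
      source' := ?_
      target' := ?_ }) ?_ ?_ ?_ ?_
  · have : H (q.1, 0) = (0, 0) := H.source _
    rw [this, hf0, Susp.mk_zero, f.2]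
  · have : H (q.1, 1) = (1, 1) := H.target _
    rw [this, hf1, Susp.mk_one, f.2]
  · exact hT.comp (show Continuous fun p : (I × B) × I => (p.1.2, H (p.1.1, p.2)) by fun_prop)
  · intro s
    ext t
    exact hpt _
  · intro b
    ext t
    change T b (H (0, t)) = (f.loop b).trans (g.loop b) t
    rw [H.apply_zero]
    change T b (Path.trans _ _ t) = _
    rw [Path.trans_apply, Path.trans_apply]
    split_ifs
    · exact hf0 _ _
    · exact hg1 _ _
  · intro b
    ext t
    change T b (H (1, t)) = (g.loop b).trans (f.loop b) t
    rw [H.apply_one]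
    change T b (Path.trans _ _ t) = _
    rw [Path.trans_apply, Path.trans_apply]
    split_ifs
    · exact hg0 _ _
    · exact hf1 _ _

/-- The square is `(t, s) ↦ Ψ[b, t] (g[b, s])`. For `s` an endpoint, `g` is at the basepoint and the
edge is `ω ∘ Ψ`; for `t` an endpoint, `Ψ` is the identity and the edge is `g`. Only joint continuity
is left to each application. -/
theorem gottlieb_mul_comm_aux
    (hT : ∀ (Ψ : BasedMap (Susp B) (Aut₁ Z)) (g : BasedMap (Susp B) Z),
      Continuous fun p : B × I × I => (Ψ.1 (Susp.mk p.1 p.2.1)).1 (g.1 (Susp.mk p.1 p.2.2)))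
    (α β : gottlieb B Z) : α * β = β * α := by
  obtain ⟨_, ⟨Ψ⟩, rfl⟩ := α
  obtain ⟨⟨g⟩, hg⟩ := β
  refine Subtype.ext (Quotient.sound (BasedMap.mul_comm_of_square
    (fun b q => (Ψ.1 (Susp.mk b q.1)).1 (g.1 (Susp.mk b q.2))) (hT Ψ g) ?_ ?_ ?_ ?_ ?_))
  · intro q
    rw [Ψ.apply_collapsed (Or.inl rfl), g.apply_collapsed (Or.inl rfl)]
    rfl
  · intro b t
    rw [g.apply_collapsed (b := b) (t := 0) (by simp)]
    rfl
  · intro b t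
    rw [g.apply_collapsed (b := b) (t := 1) (by simp)]
    rfl
  · intro b t
    rw [Ψ.apply_collapsed (b := b) (t := 0) (by simp)]
    rfl
  · intro b t
    rw [Ψ.apply_collapsed (b := b) (t := 1) (by simp)]
    rfl

theorem gottlieb_mul_comm_of_locallyCompact [LocallyCompactSpace Z] (α β : gottlieb B Z) :
    α * β = β * α := by
  refine gottlieb_mul_comm_aux (fun Ψ g => ?_) α β
  exact Continuous.eval
    (continuous_subtype_val.comp (Ψ.continuous_comp_mk.comp
      (show Continuous fun p : B × I × I => (p.1, p.2.1) by fun_prop)))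
    (g.continuous_comp_mk.comp (show Continuous fun p : B × I × I => (p.1, p.2.2) by fun_prop))

/-- This version serves `Z = map(X, Y; 0)`, which need not be locally compact. Precomposing with `g`
first moves the evaluation onto the locally compact space `B × I`. -/
theorem gottlieb_mul_comm_of_locallyCompact_source [LocallyCompactSpace B]
    (α β : gottlieb B Z) : α * β = β * α := by
  refine gottlieb_mul_comm_aux (fun Ψ g => ?_) α β
  let G : C(B × I, Z) := ⟨_, g.continuous_comp_mk⟩
  have h : Continuous fun p : B × I => (Ψ.1 (Susp.mk p.1 p.2)).1.comp G :=
    (ContinuousMap.continuous_precomp G).comp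
      (continuous_subtype_val.comp Ψ.continuous_comp_mk)
  have h' : Continuous fun p : B × I × I =>
      ((Ψ.1 (Susp.mk p.1 p.2.1)).1.comp G) (p.1, p.2.2) :=
    Continuous.eval (h.comp (show Continuous fun p : B × I × I => (p.1, p.2.1) by fun_prop))
      (by fun_prop)
  exact h'

end commute

/-! ### Homotopy extension with parameters, from a cylinder retraction -/

section extension

variable {X : Type u} [TopologicalSpace X] [Based X]

/-- The components `φ : I × X → I` and `ρ : I × X → X` of a retraction of `I × X` onto
`{0} × X ∪ I × {pt}`. -/
structure CylinderRetraction (X : Type u) [TopologicalSpace X] [Based X] where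
  φ : C(I × X, I)
  ρ : C(I × X, X)
  φ_zero : ∀ x, φ (0, x) = 0
  ρ_zero : ∀ x, ρ (0, x) = x
  φ_pt : ∀ s, φ (s, Based.pt) = s
  ρ_pt : ∀ s, ρ (s, Based.pt) = Based.pt
  φ_or_ρ : ∀ q, φ q = 0 ∨ ρ q = Based.pt

/-- The retraction solves the extension problem whose target is the subspace `{0} × X ∪ I × {pt}`
itself. -/
theorem WellPointed.nonempty_cylinderRetraction (h : WellPointed X) :
    Nonempty (CylinderRetraction X) := by
  obtain ⟨H, h0, h1⟩ := h {q : I × X // q.1 = 0 ∨ q.2 = Based.pt}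
    ⟨fun x => ⟨(0, x), Or.inl rfl⟩, by fun_prop⟩ ⟨fun s => ⟨(s, Based.pt), Or.inr rfl⟩, by fun_prop⟩
    rfl
  exact ⟨{
    φ := ⟨fun q => (H q).1.1, by fun_prop⟩
    ρ := ⟨fun q => (H q).1.2, by fun_prop⟩
    φ_zero := fun x => by simp [h0]
    ρ_zero := fun x => by simp [h0]
    φ_pt := fun s => by simp [h1]
    ρ_pt := fun s => by simp [h1]
    φ_or_ρ := fun q => (H q).2 }⟩

namespace CylinderRetraction

variable {P : Type v} {W : Type w} (r : CylinderRetraction X) (G : P × X → W) (D : P × I → W)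

open Classical in
/-- The extension to `I × P × X` of the map that is `G` on `{0} × P × X` and `D` on
`I × P × {pt}`. -/
noncomputable def extend (q : I × P × X) : W :=
  if r.φ (q.1, q.2.2) = 0 then G (q.2.1, r.ρ (q.1, q.2.2)) else D (q.2.1, r.φ (q.1, q.2.2))

variable {G D}

/-- The closed sets `φ = 0` and `ρ = pt` cover the cylinder, and `h` makes the two formulas agree
where they meet. An explicit retraction allows an arbitrary parameter space `P`. -/
theorem continuous_extend [TopologicalSpace P] [TopologicalSpace W] [T1Space X]
    (hG : Continuous G) (hD : Continuous D)
    (h : ∀ p, D (p, 0) = G (p, Based.pt)) : Continuous (r.extend G D) := by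
  have h1 : IsClosed {q : I × P × X | r.φ (q.1, q.2.2) = 0} :=
    isClosed_singleton.preimage (f := fun q : I × P × X => r.φ (q.1, q.2.2)) (by fun_prop)
  have h2 : IsClosed {q : I × P × X | r.ρ (q.1, q.2.2) = Based.pt} :=
    isClosed_singleton.preimage (f := fun q : I × P × X => r.ρ (q.1, q.2.2)) (by fun_prop)
  rw [← continuousOn_univ,
    ← Set.eq_univ_of_forall (s := _ ∪ _) fun q : I × P × X => r.φ_or_ρ (q.1, q.2.2)]
  refine ContinuousOn.union_of_isClosed ?_ ?_ h1 h2
  · refine ContinuousOn.congr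
      (f := fun q : I × P × X => G (q.2.1, r.ρ (q.1, q.2.2))) (by fun_prop) fun q hq => ?_
    exact if_pos hq
  · refine ContinuousOn.congr
      (f := fun q : I × P × X => D (q.2.1, r.φ (q.1, q.2.2))) (by fun_prop) fun q hq => ?_
    replace hq : r.ρ (q.1, q.2.2) = Based.pt := hq
    unfold extend
    split_ifs with h0
    · dsimp only
      rw [hq, h0, h]
    · rfl

theorem extend_zero (p : P) (x : X) : r.extend G D (0, p, x) = G (p, x) := by
  simp [extend, r.φ_zero, r.ρ_zero]

theorem extend_pt (h : ∀ p, D (p, 0) = G (p, Based.pt)) (s : I) (p : P) :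
    r.extend G D (s, p, Based.pt) = D (p, s) := by
  unfold extend
  simp only [r.φ_pt, r.ρ_pt]
  split_ifs with h0
  · rw [h0, h]
  · rfl

/-- Used at parameters collapsed in the suspension, where it keeps the extension at the basepoint,
and at the constant end of a null-homotopy. -/
theorem extend_of_const {p : P} (h : ∀ x, G (p, x) = D (p, 0)) (s : I) (x : X) :
    r.extend G D (s, p, x) = D (p, r.φ (s, x)) := by
  unfold extend
  split_ifs with h0
  · rw [h, h0]
  · rfl

end CylinderRetraction

end extension

/-! ### Postcomposition on null components -/

section postcompose

variable (X : Type u) {W : Type w} {Y : Type v} [TopologicalSpace X] [TopologicalSpace W]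
  [TopologicalSpace Y] [Based W] [Based Y]

theorem homotopic_const_comp {X : Type u} [TopologicalSpace X] (g : BasedMap W Y)
    (f : NullMap X W) :
    ContinuousMap.Homotopic (g.1.comp f.1) (ContinuousMap.const X (Based.pt : Y)) := by
  have h : g.1.comp (ContinuousMap.const X (Based.pt : W)) = ContinuousMap.const X Based.pt :=
    ContinuousMap.ext fun _ => g.2
  exact h ▸ ContinuousMap.Homotopic.comp (.refl g.1) f.2

/-- Postcomposition with a based map `g : W → Y`, as a map `map(X, W; 0) → map(X, Y; 0)`. -/
def nullPostcomp (g : BasedMap W Y) : BasedMap (NullMap X W) (NullMap X Y) where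
  val := ⟨fun f => ⟨g.1.comp f.1, homotopic_const_comp g f⟩,
    Continuous.subtype_mk ((ContinuousMap.continuous_postcomp g.1).comp continuous_subtype_val) _⟩
  property := Subtype.ext (ContinuousMap.ext fun _ => g.2)

end postcompose

theorem BasedMap.continuous_uncurry_nullMap {A : Type w} {X : Type u} {W : Type v}
    [TopologicalSpace A] [TopologicalSpace X] [TopologicalSpace W] [Based A] [Based W]
    [LocallyCompactSpace X]
    (f : BasedMap (Susp A) (NullMap X W)) :
    Continuous fun p : (A × I) × X => (f.1 (Susp.mk p.1.1 p.1.2)).1 p.2 :=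
  Continuous.eval ((continuous_subtype_val.comp f.continuous_comp_mk).comp continuous_fst)
    continuous_snd

/-! ### The split exact sequence for all homotopy classes -/

section exactness

variable {A : Type w} {X : Type u} {W : Type v} [TopologicalSpace A] [TopologicalSpace X]
  [TopologicalSpace W] [Based A] [Based X] [Based W]

theorem inducedHom_evNull_adjointHom (α : BasedClasses (Susp (Smash A X)) W) :
    inducedHom A (evNull X W) (adjointHom A X W α) = 1 := by
  obtain ⟨F⟩ := α
  refine congrArg (Quotient.mk _) (BasedMap.ext_loop fun a => ?_)
  ext t
  change F.1 (Susp.mk (Smash.mk a Based.pt) t) = Based.pt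
  rw [Smash.mk_pt_right, Susp.mk_pt, F.2]

theorem inducedHom_evNull_nullSection [PathConnectedSpace W] (γ : BasedClasses (Susp A) W) :
    inducedHom A (evNull X W) (inducedHom A (nullSection X W) γ) = γ := by
  obtain ⟨f⟩ := γ
  rfl

/-- Every class in `[Σ A, map(X, W; 0)]`, divided by its image under the null section, comes
from `[Σ(A ∧ X), W]`. -/
theorem exists_adjointHom_eq [T1Space X] [LocallyCompactSpace X] [PathConnectedSpace W]
    (hX : WellPointed X) (β : BasedClasses (Susp A) (NullMap X W)) :
    ∃ α, adjointHom A X W α =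
      β * (inducedHom A (nullSection X W) (inducedHom A (evNull X W) β))⁻¹ := by
  obtain ⟨r⟩ := hX.nonempty_cylinderRetraction
  obtain ⟨f⟩ := β
  let γ : BasedMap (Susp A) W := (evNull X W).comp f
  let g : BasedMap (Susp A) (NullMap X W) := f.mul ((nullSection X W).comp γ).inv
  let G : (A × I) × X → W := fun p => (g.1 (Susp.mk p.1.1 p.1.2)).1 p.2
  -- At the basepoint of `X`, `g` traces `γ * γ⁻¹`. The homotopy `reflTransSymm` starts at the
  -- constant loop, so it is run backwards to contract this trace.
  let D : (A × I) × I → W := fun p =>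
    Path.Homotopy.reflTransSymm (γ.loop p.1.1) (unitInterval.symm p.2, p.1.2)
  have hG : Continuous G := g.continuous_uncurry_nullMap
  have hD : Continuous D := by
    refine γ.continuous_loop.comp (show Continuous fun p : (A × I) × I => (p.1.1,
      (⟨Path.Homotopy.reflTransSymmAux (unitInterval.symm p.2, p.1.2), _⟩ : I)) from ?_)
    fun_prop
  have hGD : ∀ p, D (p, 0) = G (p, Based.pt) := by
    rintro ⟨a, t⟩
    have : D ((a, t), 0) = ((γ.loop a).trans (γ.loop a).symm) t := by
      change Path.Homotopy.reflTransSymm (γ.loop a) (unitInterval.symm 0, t) = _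
      rw [unitInterval.symm_zero, ContinuousMap.HomotopyWith.apply_one]
      rfl
    rw [this]
    change _ = ((f.loop a).trans (((nullSection X W).comp γ).inv.loop a) t).1 Based.pt
    rw [Path.trans_apply, Path.trans_apply]
    split_ifs <;> rfl
  have hGc : ∀ a t, (a = Based.pt ∨ t = 0 ∨ t = 1) → ∀ x, G ((a, t), x) = Based.pt := by
    intro a t h x
    change (g.1 (Susp.mk a t)).1 x = _
    rw [g.apply_collapsed h]
    rfl
  have hDc : ∀ a t, (a = Based.pt ∨ t = 0 ∨ t = 1) → ∀ s, D ((a, t), s) = Based.pt := by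
    rintro a t (rfl | rfl | rfl) s
    · change γ.loop _ _ = _
      rw [γ.loop_pt]
      rfl
    · exact (Path.Homotopy.reflTransSymm (γ.loop a)).source _
    · exact (Path.Homotopy.reflTransSymm (γ.loop a)).target _
  have hD1 : ∀ p, D (p, 1) = Based.pt := by
    rintro ⟨a, t⟩
    change Path.Homotopy.reflTransSymm (γ.loop a) (unitInterval.symm 1, t) = _
    rw [unitInterval.symm_one, ContinuousMap.HomotopyWith.apply_zero]
    rfl
  have hK := r.continuous_extend hG hD hGD
  have hKc : ∀ a t, (a = Based.pt ∨ t = 0 ∨ t = 1) → ∀ s x,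
      r.extend G D (s, (a, t), x) = Based.pt := by
    intro a t h s x
    rw [r.extend_of_const (fun x => by rw [hGc a t h, hDc a t h]), hDc a t h]
  -- At the end of the extension the trace is constant, so the family factors through `Σ(A ∧ X)`.
  -- The extension itself is the homotopy from `g` to the adjoint of `F`: the function space
  -- consists of unbased maps, so the trace may move.
  let F : BasedMap (Susp (Smash A X)) W := BasedMap.ofSmash (fun p => r.extend G D (1, p))
    (hK.comp (by fun_prop)) (by
      rintro a t x h
      by_cases h' : a = Based.pt ∨ t = 0 ∨ t = 1
      · exact hKc a t h' _ _
      · obtain rfl : x = Based.pt := by tauto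
        exact (r.extend_pt hGD 1 (a, t)).trans (hD1 _))
  refine ⟨Quotient.mk _ F, Quotient.sound ?_⟩
  have hf : ∀ s a t, (a = Based.pt ∨ t = 0 ∨ t = 1) → ∀ x,
      r.extend G D (s, (a, t), x) = ContinuousMap.const X (Based.pt : W) x :=
    fun s a t h x => hKc a t h s x
  have hc : ∀ s, Continuous fun p : (A × I) × X => r.extend G D (s, p) :=
    fun s => hK.comp (by fun_prop)
  refine Setoid.symm (BasedMap.equiv_of_family
    (fun q => (BasedMap.ofMaps _ (hc q.1) (hf q.1)).loop q.2) ?_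
    (fun s => BasedMap.loop_pt _) ?_ (fun _ => rfl))
  · refine Continuous.subtype_mk (ContinuousMap.continuous_of_continuous_uncurry _ ?_) _
    exact hK.comp (show Continuous fun p : ((I × A) × I) × X =>
      (p.1.1.1, (p.1.1.2, p.1.2), p.2) by fun_prop)
  · intro a
    ext t
    refine Subtype.ext (ContinuousMap.ext fun x => ?_)
    exact r.extend_zero (G := G) (D := D) (a, t) x

theorem adjointHom_injective [T1Space X] [LocallyCompactSpace X] (hX : WellPointed X) :
    Function.Injective (adjointHom A X W) := by
  obtain ⟨r⟩ := hX.nonempty_cylinderRetraction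
  rw [injective_iff_map_eq_one]
  rintro ⟨F⟩ hF
  obtain ⟨K, hK, hK0, hK1⟩ := BasedMap.exists_family (Quotient.exact hF :
    F.adjoint ≈ (BasedMap.one : BasedMap (Susp A) (NullMap X W)))
  let G : (I × A × I) × X → W := fun p => ((K p.1.1).1 (Susp.mk p.1.2.1 p.1.2.2)).1 p.2
  -- The null-homotopy `K` may move the basepoint of `X`. Its trace is rewound to time `0`, where it
  -- is constant because `F` is defined on the smash product.
  let D : (I × A × I) × I → W := fun p =>
    G ((p.1.1 * unitInterval.symm p.2, p.1.2), Based.pt)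
  have hG : Continuous G := by
    refine Continuous.eval (continuous_subtype_val.comp (hK.comp
      (show Continuous fun p : (I × A × I) × X => (p.1.1, Susp.mk p.1.2.1 p.1.2.2) from ?_)) )
      continuous_snd
    exact (show Continuous fun p : (I × A × I) × X => p.1.1 by fun_prop).prodMk
      (Susp.continuous_mk.comp (by fun_prop : Continuous fun p : (I × A × I) × X => p.1.2))
  have hD : Continuous D := hG.comp (by fun_prop)
  have hGD : ∀ p, D (p, 0) = G (p, Based.pt) := by
    rintro ⟨s, p⟩
    simp [D]
  have hGc : ∀ s a t, (a = Based.pt ∨ t = 0 ∨ t = 1) → ∀ x,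
      G ((s, a, t), x) = Based.pt := by
    intro s a t h x
    change ((K s).1 (Susp.mk a t)).1 x = _
    rw [(K s).apply_collapsed h]
    rfl
  have hG0 : ∀ a t x, G ((0, a, t), x) = F.1 (Susp.mk (Smash.mk a x) t) := by
    intro a t x
    change ((K 0).1 (Susp.mk a t)).1 x = _
    rw [hK0]
    rfl
  have hG1 : ∀ p x, G ((1, p), x) = Based.pt := by
    intro p x
    change ((K 1).1 (Susp.mk p.1 p.2)).1 x = _
    rw [hK1]
    rfl
  have hG0' : ∀ p, G ((0, p), Based.pt) = Based.pt := fun p => by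
    rw [hG0 p.1 p.2, Smash.mk_pt_right, Susp.mk_pt, F.2]
  have hDc : ∀ s a t, (a = Based.pt ∨ t = 0 ∨ t = 1) → ∀ u,
      D ((s, a, t), u) = Based.pt := fun s a t h u => hGc _ a t h _
  have hE := r.continuous_extend hG hD hGD
  have hEc : ∀ a t, (a = Based.pt ∨ t = 0 ∨ t = 1) → ∀ u s x,
      r.extend G D (u, (s, a, t), x) = Based.pt := by
    intro a t h u s x
    rw [r.extend_of_const (fun x => by rw [hGc s a t h, hDc s a t h]), hDc s a t h]
  -- At `x = pt` the extension is `G` at time `s * (1 - u)`, which is trivial on these two edges of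
  -- the `(s, u)`-square.
  have hV : ∀ u s, (s = 0 ∨ u = 1) →
      VanishesOnCollapse fun p : (A × I) × X => r.extend G D (u, (s, p.1), p.2) := by
    rintro u s hus a t x h
    by_cases h' : a = Based.pt ∨ t = 0 ∨ t = 1
    · exact hEc a t h' _ _ _
    · obtain rfl : x = Based.pt := by tauto
      dsimp only
      rw [r.extend_pt hGD]
      rcases hus with rfl | rfl <;> simp [D, hG0']
  have hc : ∀ u s, Continuous fun p : (A × I) × X => r.extend G D (u, (s, p.1), p.2) :=
    fun u s => hE.comp (by fun_prop)
  refine Quotient.sound ?_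
  -- first move along the cylinder at the start of the homotopy, then along the homotopy,
  -- and finally contract the trace of the basepoint
  have e1 : F ≈ BasedMap.ofSmash _ (hc 1 0) (hV 1 0 (Or.inl rfl)) := by
    refine BasedMap.equiv_of_smash_family
      (fun u p => r.extend G D (u, (0, p.1), p.2)) (hE.comp (by fun_prop))
      (fun u => hV u 0 (Or.inl rfl)) ?_ (fun _ _ _ => rfl)
    intro a x t
    dsimp only
    rw [r.extend_zero, hG0]
  have e2 : BasedMap.ofSmash _ (hc 1 0) (hV 1 0 (Or.inl rfl)) ≈
      BasedMap.ofSmash _ (hc 1 1) (hV 1 1 (Or.inr rfl)) :=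
    BasedMap.equiv_of_smash_family
      (fun s p => r.extend G D (1, (s, p.1), p.2)) (hE.comp (by fun_prop))
      (fun s => hV 1 s (Or.inr rfl)) (fun _ _ _ => rfl) (fun _ _ _ => rfl)
  have e3 : BasedMap.ofSmash _ (hc 1 1) (hV 1 1 (Or.inr rfl)) ≈ BasedMap.one := by
    refine BasedMap.equiv_of_smash_family
      -- At time `1` the map `G` is constant, so only `D` composed with `φ` remains; lowering the
      -- time to `0` makes it trivial. The points `x = pt` stay fixed since `φ (1, pt) = 1`.
      (fun s p => D ((unitInterval.symm s, p.1), r.φ (1, p.2))) (hD.comp (by fun_prop)) ?_ ?_ ?_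
    · intro s a t x h
      by_cases h' : a = Based.pt ∨ t = 0 ∨ t = 1
      · exact hDc _ a t h' _
      · obtain rfl : x = Based.pt := by tauto
        simp [D, r.φ_pt, hG0']
    · intro a x t
      rw [BasedMap.ofSmash_mk, r.extend_of_const (fun x => by simp [D, hG1])]
      simp
    · intro a x t
      simp only [unitInterval.symm_one, D, zero_mul, hG0']
      rfl
  exact Setoid.trans e1 (Setoid.trans e2 e3)

end exactness

/-- Needed to take `W = aut₁ Y` in `exists_adjointHom_eq`, whose null section requires a
path-connected target. -/
theorem pathConnectedSpace_aut₁ (Y : Type v) [TopologicalSpace Y] :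
    PathConnectedSpace (Aut₁ Y) := by
  have key : ∀ g : Aut₁ Y, Joined g Based.pt := by
    intro g
    obtain ⟨H⟩ := g.2
    refine ⟨{
      toFun := fun s => ⟨⟨fun y => H (s, y), by fun_prop⟩, ⟨{
        -- Waiting at `H s` until time `s` and then following `H` joins the intermediate map to the
        -- identity.
        toFun := fun q => H (max s q.1, q.2)
        continuous_toFun := by fun_prop
        map_zero_left := by simp
        map_one_left := fun x => by
          rw [max_eq_right unitInterval.le_one', H.apply_one] }⟩⟩
      continuous_toFun := Continuous.subtype_mk (ContinuousMap.continuous_of_continuous_uncurry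
        (fun s => (⟨fun y => H (s, y), by fun_prop⟩ : C(Y, Y))) H.continuous) _
      source' := ?_
      target' := ?_ }⟩
    · exact Subtype.ext (ContinuousMap.ext fun y => H.apply_zero y)
    · exact Subtype.ext (ContinuousMap.ext fun y => H.apply_one y)
  exact ⟨⟨Based.pt⟩, fun f g => (key f).trans (key g).symm⟩

/-! ### Restriction to Gottlieb groups -/

section restrict

variable {A : Type w} {X : Type u} {Y : Type v} [TopologicalSpace A] [TopologicalSpace X]
  [TopologicalSpace Y] [Based A] [Based X] [Based Y]

/-- A lift `Φ` to `aut₁ Y` acts on `map(X, Y; 0)` by `g ↦ (x ↦ Φ[a ∧ x, t] (g x))`; the action on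
the constant map at the basepoint is the adjoint of `ω ∘ Φ`. -/
theorem adjointHom_mem_gottlieb [LocallyCompactSpace X] [LocallyCompactSpace Y]
    {α : BasedClasses (Susp (Smash A X)) Y} (hα : α ∈ gottlieb (Smash A X) Y) :
    adjointHom A X Y α ∈ gottlieb A (NullMap X Y) := by
  obtain ⟨⟨Φ⟩, rfl⟩ := hα
  let ψ : (((A × I) × NullMap X Y) × X) → Y := fun p =>
    (Φ.1 (Susp.mk (Smash.mk p.1.1.1 p.2) p.1.1.2)).1 (p.1.2.1 p.2)
  have hψ : Continuous ψ := by
    refine Continuous.eval (continuous_subtype_val.comp (Φ.1.continuous.comp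
      (Susp.continuous_mk.comp (Continuous.prodMk (Smash.continuous_mk.comp
        (show Continuous fun p : ((A × I) × NullMap X Y) × X => (p.1.1.1, p.2) by fun_prop))
        (by fun_prop : Continuous fun p : ((A × I) × NullMap X Y) × X => p.1.1.2)))))
      (Continuous.eval ?_ continuous_snd)
    exact continuous_subtype_val.comp (by fun_prop)
  have hc : ∀ a t, (a = Based.pt ∨ t = 0 ∨ t = 1) → ∀ g x, ψ (((a, t), g), x) = g.1 x := by
    intro a t h g x
    have : Φ.1 (Susp.mk (Smash.mk a x) t) = Based.pt :=
      Φ.apply_collapsed (by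
        rcases h with rfl | h
        · exact Or.inl (Smash.mk_pt_left x)
        · exact Or.inr h)
    change (Φ.1 (Susp.mk (Smash.mk a x) t)).1 (g.1 x) = _
    rw [this]
    rfl
  let φ : (A × I) × NullMap X Y → NullMap X Y := fun p =>
    ⟨⟨fun x => ψ (p, x), by fun_prop⟩,
      ContinuousMap.Homotopic.trans ⟨{
        toFun := fun q => ψ (((p.1.1, unitInterval.symm q.1 * p.1.2), p.2), q.2)
        continuous_toFun := by fun_prop
        map_zero_left := by simp
        map_one_left := fun x => hc _ _ (by simp) _ _ }⟩ p.2.2⟩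
  have hφ : Continuous φ := Continuous.subtype_mk
    (ContinuousMap.continuous_of_continuous_uncurry
      (fun p => (⟨fun x => ψ (p, x), by fun_prop⟩ : C(X, Y))) hψ) _
  refine ⟨Quotient.mk _ (BasedMap.ofMaps φ hφ fun a t h g =>
    Subtype.ext (ContinuousMap.ext fun x => hc a t h g x)), ?_⟩
  refine congrArg (Quotient.mk _) (BasedMap.ext_loop fun a => ?_)
  ext t
  rfl

/-- Here the action is the postcomposition `g ↦ Φ[a, t] ∘ g`, which preserves constant maps. -/
theorem nullSection_mem_gottlieb [LocallyCompactSpace X] [LocallyCompactSpace Y]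
    [PathConnectedSpace Y] {γ : BasedClasses (Susp A) Y} (hγ : γ ∈ gottlieb A Y) :
    inducedHom A (nullSection X Y) γ ∈ gottlieb A (NullMap X Y) := by
  obtain ⟨⟨Φ⟩, rfl⟩ := hγ
  let φ : (A × I) × NullMap X Y → NullMap X Y := fun p =>
    ⟨(Φ.1 (Susp.mk p.1.1 p.1.2)).1.comp p.2.1,
      ((Φ.1 (Susp.mk p.1.1 p.1.2)).2.comp (.refl p.2.1)).trans p.2.2⟩
  have hφ : Continuous φ := Continuous.subtype_mk (Continuous.compCM
    (continuous_subtype_val.comp (Φ.continuous_comp_mk.comp continuous_fst))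
    (continuous_subtype_val.comp continuous_snd)) _
  refine ⟨Quotient.mk _ (BasedMap.ofMaps φ hφ fun a t h g =>
    Subtype.ext (ContinuousMap.ext fun x => ?_)), ?_⟩
  · change (Φ.1 (Susp.mk a t)).1 (g.1 x) = g.1 x
    rw [Φ.apply_collapsed h]
    rfl
  · refine congrArg (Quotient.mk _) (BasedMap.ext_loop fun a => ?_)
    ext t
    rfl

/-- Evaluation on `map(X, Y; 0)` need not be jointly continuous. Restricting to constant maps first
leaves only evaluations on the locally compact spaces `Y` and `X`. -/
theorem continuous_aut_nullMap_section [LocallyCompactSpace X] [LocallyCompactSpace Y]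
    [PathConnectedSpace Y] (Ψ : BasedMap (Susp A) (Aut₁ (NullMap X Y))) :
    Continuous fun p : ((A × I) × Y) × X =>
      ((Ψ.1 (Susp.mk p.1.1.1 p.1.1.2)).1 ((nullSection X Y).1 p.1.2)).1 p.2 := by
  have h1 : Continuous fun p : A × I =>
      (Ψ.1 (Susp.mk p.1 p.2)).1.comp (nullSection X Y).1 :=
    (ContinuousMap.continuous_precomp _).comp (continuous_subtype_val.comp Ψ.continuous_comp_mk)
  have h2 : Continuous fun p : (A × I) × Y =>
      ((Ψ.1 (Susp.mk p.1.1 p.1.2)).1.comp (nullSection X Y).1) p.2 :=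
    Continuous.eval (h1.comp continuous_fst) continuous_snd
  exact Continuous.eval ((continuous_subtype_val.comp h2).comp continuous_fst) continuous_snd

/-- Conjugating by section and evaluation, `ev ∘ Ψ[a, t] ∘ σ` is a family of self-maps of `Y` that
lifts `ev_* β`. -/
theorem evNull_mem_gottlieb [LocallyCompactSpace X] [LocallyCompactSpace Y]
    [PathConnectedSpace Y] {β : BasedClasses (Susp A) (NullMap X Y)}
    (hβ : β ∈ gottlieb A (NullMap X Y)) : inducedHom A (evNull X Y) β ∈ gottlieb A Y := by
  obtain ⟨⟨Ψ⟩, rfl⟩ := hβ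
  refine ⟨Quotient.mk _ (BasedMap.ofMaps
    (fun p : (A × I) × Y => ((Ψ.1 (Susp.mk p.1.1 p.1.2)).1 ((nullSection X Y).1 p.2)).1 Based.pt)
    ((continuous_aut_nullMap_section Ψ).comp
      (show Continuous fun p : (A × I) × Y => (p, (Based.pt : X)) by fun_prop)) ?_), ?_⟩
  · intro a t h y
    dsimp only
    rw [Ψ.apply_collapsed h]
    rfl
  · refine congrArg (Quotient.mk _) (BasedMap.ext_loop fun a => ?_)
    ext t
    rfl

/-- A family of self-maps of `map(X, Y; 0)` gives a family of maps `X → aut₁ Y` by restriction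
to the constant maps. -/
theorem exists_aut_nullMap [LocallyCompactSpace X] [LocallyCompactSpace Y]
    [PathConnectedSpace Y] {β : BasedClasses (Susp A) (NullMap X Y)}
    (hβ : β ∈ gottlieb A (NullMap X Y)) :
    ∃ θ : BasedClasses (Susp A) (NullMap X (Aut₁ Y)),
      inducedHom A (nullPostcomp X (evalAut Y)) θ = β := by
  obtain ⟨⟨Ψ⟩, rfl⟩ := hβ
  -- For fixed `x`, the value at `x` of `Ψ` applied to the constant map at `y` is a self-map of `Y`
  -- in the variable `y`; setting `y = pt` recovers the given class.
  let ψ : ((A × I) × X) × Y → Y := fun p =>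
    ((Ψ.1 (Susp.mk p.1.1.1 p.1.1.2)).1 ((nullSection X Y).1 p.2)).1 p.1.2
  have hψ : Continuous ψ := (continuous_aut_nullMap_section Ψ).comp
    (show Continuous fun p : ((A × I) × X) × Y => ((p.1.1, p.2), p.1.2) by fun_prop)
  have hc : ∀ a t, (a = Based.pt ∨ t = 0 ∨ t = 1) → ∀ x y, ψ (((a, t), x), y) = y := by
    intro a t h x y
    change ((Ψ.1 (Susp.mk a t)).1 ((nullSection X Y).1 y)).1 x = y
    rw [Ψ.apply_collapsed h]
    rfl
  let φ : (A × I) × X → Aut₁ Y := fun p =>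
    ⟨⟨fun y => ψ (p, y), by fun_prop⟩, ⟨{
      toFun := fun q => ψ (((p.1.1, unitInterval.symm q.1 * p.1.2), p.2), q.2)
      continuous_toFun := by fun_prop
      map_zero_left := by simp
      map_one_left := fun x => hc _ _ (by simp) _ _ }⟩⟩
  have hφ : Continuous φ := Continuous.subtype_mk
    (ContinuousMap.continuous_of_continuous_uncurry
      (fun p => (⟨fun y => ψ (p, y), by fun_prop⟩ : C(Y, Y))) hψ) _
  refine ⟨Quotient.mk _ (BasedMap.ofMaps φ hφ fun a t h x =>
    Subtype.ext (ContinuousMap.ext fun y => hc a t h x y)), ?_⟩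
  refine congrArg (Quotient.mk _) (BasedMap.ext_loop fun a => ?_)
  ext t
  rfl

/-- A Gottlieb class in `[Σ A, map(X, Y; 0)]` that evaluates trivially is the adjoint of a
Gottlieb class. -/
theorem exists_gottlieb_adjointHom_eq [T1Space X] [LocallyCompactSpace X]
    [LocallyCompactSpace Y] [PathConnectedSpace Y] (hX : WellPointed X)
    {β : BasedClasses (Susp A) (NullMap X Y)} (hβ : β ∈ gottlieb A (NullMap X Y))
    (h : inducedHom A (evNull X Y) β = 1) :
    ∃ α ∈ gottlieb (Smash A X) Y, adjointHom A X Y α = β := by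
  have := pathConnectedSpace_aut₁ Y
  obtain ⟨θ, rfl⟩ := exists_aut_nullMap hβ
  obtain ⟨α, hα⟩ := exists_adjointHom_eq hX θ
  refine ⟨inducedHom _ (evalAut Y) α, ⟨α, rfl⟩, ?_⟩
  have e1 : adjointHom A X Y (inducedHom _ (evalAut Y) α) =
      inducedHom A (nullPostcomp X (evalAut Y)) (adjointHom A X (Aut₁ Y) α) := by
    obtain ⟨F⟩ := α
    refine congrArg (Quotient.mk _) (BasedMap.ext_loop fun a => ?_)
    ext t
    rfl
  -- Naturality of evaluation and null section in the target: the divisor of `θ` maps to `σ_* (ev_*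
  -- β)`, which is trivial by `h`.
  have e2 : inducedHom A (nullPostcomp X (evalAut Y))
      (inducedHom A (nullSection X (Aut₁ Y)) (inducedHom A (evNull X (Aut₁ Y)) θ)) =
      inducedHom A (nullSection X Y) (inducedHom A (evNull X Y)
        (inducedHom A (nullPostcomp X (evalAut Y)) θ)) := by
    obtain ⟨f⟩ := θ
    rfl
  rw [e1, hα, map_mul, map_inv, e2, h, map_one, inv_one, mul_one]

end restrict

/-! ### The split short exact sequence of Gottlieb groups -/

theorem mainTheorem1 {A : Type w} {X : Type u} {Y : Type v}
    [TopologicalSpace A] [TopologicalSpace X] [TopologicalSpace Y]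
    [Based A] [Based X] [Based Y]
    [T2Space A] [T2Space X] [T2Space Y]
    [LocallyCompactSpace A] [LocallyCompactSpace X] [LocallyCompactSpace Y]
    (hA : WellPointed A) (hX : WellPointed X) (hY : WellPointed Y)
    [ConnectedSpace X] [PathConnectedSpace Y] :
    -- the three groups are abelian
    (∀ α β : gottlieb (Smash A X) Y, α * β = β * α) ∧
    (∀ α β : gottlieb A (NullMap X Y), α * β = β * α) ∧
    (∀ α β : gottlieb A Y, α * β = β * α) ∧
    -- the adjunction, the evaluation and the null section restrict to homomorphisms
    -- between them, which form a split short exact sequence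
    ∃ (j : gottlieb (Smash A X) Y →* gottlieb A (NullMap X Y))
      (p : gottlieb A (NullMap X Y) →* gottlieb A Y)
      (s : gottlieb A Y →* gottlieb A (NullMap X Y)),
      (∀ α, (j α : BasedClasses (Susp A) (NullMap X Y)) = adjointHom A X Y α) ∧
      (∀ β, (p β : BasedClasses (Susp A) Y) = inducedHom A (evNull X Y) β) ∧
      (∀ γ, (s γ : BasedClasses (Susp A) (NullMap X Y)) = inducedHom A (nullSection X Y) γ) ∧
      Function.Injective j ∧
      j.range = p.ker ∧
      Function.Surjective p ∧
      p.comp s = MonoidHom.id (gottlieb A Y) := by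
  refine ⟨gottlieb_mul_comm_of_locallyCompact, gottlieb_mul_comm_of_locallyCompact_source,
    gottlieb_mul_comm_of_locallyCompact,
    ((adjointHom A X Y).comp (Subgroup.subtype _)).codRestrict _
      fun α => adjointHom_mem_gottlieb α.2,
    ((inducedHom A (evNull X Y)).comp (Subgroup.subtype _)).codRestrict _
      fun β => evNull_mem_gottlieb β.2,
    ((inducedHom A (nullSection X Y)).comp (Subgroup.subtype _)).codRestrict _
      fun γ => nullSection_mem_gottlieb γ.2,
    fun _ => rfl, fun _ => rfl, fun _ => rfl, ?_, ?_, ?_, ?_⟩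
  · intro α β h
    exact Subtype.ext (adjointHom_injective hX (congrArg Subtype.val h))
  · refine le_antisymm ?_ fun β hβ => ?_
    · rintro _ ⟨α, rfl⟩
      exact Subtype.ext (inducedHom_evNull_adjointHom α.1)
    · obtain ⟨α, hα, h⟩ := exists_gottlieb_adjointHom_eq hX β.2 (congrArg Subtype.val hβ)
      exact ⟨⟨α, hα⟩, Subtype.ext h⟩
  · intro γ
    exact ⟨⟨_, nullSection_mem_gottlieb γ.2⟩, Subtype.ext (inducedHom_evNull_nullSection γ.1)⟩
  · ext γ
    exact inducedHom_evNull_nullSection γ.1
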